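/- Let $K$ be a number field of degree $k=[K:\mathbb{Q}]$ with ring of integers $\mathfrak{o}$, and let $d\ge 2$ be an integer. For an integral basis $\mathbb{E}=\{e_1,\dots,e_k\}$ of $\mathfrak{o}$ and $H\in\mathbb{N}$ put $$O(H,\mathbb{E})=\Big\{\sum_{j=1}^k a_je_j \;:\; a_j\in\mathbb{Z},\ -H\le a_j<H\Big\}.$$ For $n\ge 1$, the density of a set $T\subseteq\mathfrak{o}^{n}$ with respect to $\mathbb{E}$ is $\rho_{\mathbb{E}}(T)=\lim_{H\to\infty}\frac{|T\cap O(H,\mathbb{E})^{n}|}{(2H)^{nk}}$, if this limit exists. For a non-zero prime ideal $\mathfrak{p}$ of $\mathfrak{o}$, a polynomial $a_0+a_1x+\dots+a_dx^d$ of degree $d$ over $\mathfrak{o}$, identified with $(a_0,\dots,a_d)\in\mathfrak{o}^{d+1}$, is called $\mathfrak{p}$-Eisenstein if $a_d\notin\mathfrak{p}$, $a_0\notin\mathfrak{p}^2$ and $a_i\in\mathfrak{p}$ for all $0\le i\le d-1$. Let $\Gamma^d\subseteq\mathfrak{o}^{d+1}$ be the set of Eisenstein polynomials of degree $d$, that is,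 of those that are $\mathfrak{p}$-Eisenstein for some non-zero prime ideal $\mathfrak{p}$. Then for every integral basis $\mathbb{E}$ of $\mathfrak{o}$ the density $\rho_{\mathbb{E}}(\Gamma^d)$ exists, it does not depend on $\mathbb{E}$, and $$\rho_{\mathbb{E}}(\Gamma^d)=1-\prod_{\mathfrak{p}}\left(1-\frac{(N(\mathfrak{p})-1)^2}{N(\mathfrak{p})^{d+2}}\right),$$ where the (convergent) product runs over all non-zero prime ideals $\mathfrak{p}$ of $\mathfrak{o}$ and $N(\mathfrak{p})=|\mathfrak{o}/\mathfrak{p}|$. -/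

import Mathlib

open scoped NumberField

namespace EisensteinDensity

/-- An integral basis of the ring of integers of `K`, indexed by `1, …, k` with `k = [K : ℚ]`. -/
abbrev IntegralBasis (K : Type*) [Field K] [NumberField K] :=
  Module.Basis (Fin (Module.finrank ℚ K)) ℤ (𝓞 K)

/-- The box `O(H, 𝔼)` of all `∑ⱼ aⱼ eⱼ` whose integer coordinates satisfy `-H ≤ aⱼ < H`. -/
def box {K : Type*} [Field K] [NumberField K] (E : IntegralBasis K) (H : ℕ) : Set (𝓞 K) :=
  {x | ∀ j, E.repr x j ∈ Set.Ico (-(H : ℤ)) (H : ℤ)}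

/-- The cartesian power `O(H, 𝔼)ⁿ`. -/
def boxPow {K : Type*} [Field K] [NumberField K] (E : IntegralBasis K) (n H : ℕ) :
    Set (Fin n → 𝓞 K) :=
  {a | ∀ i, a i ∈ box E H}

/-- The boxes are finite, so that `Set.ncard` below is the true cardinality. -/
theorem boxPow_finite {K : Type*} [Field K] [NumberField K] (E : IntegralBasis K) (n H : ℕ) :
    (boxPow E n H).Finite := by
  have hbox : (box E H).Finite := by
    have h : (Set.univ.pi fun _ : Fin (Module.finrank ℚ K) =>
        Set.Ico (-(H : ℤ)) (H : ℤ)).Finite := Set.Finite.pi fun _ => Set.finite_Ico _ _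
    refine (h.preimage (f := E.equivFun) E.equivFun.injective.injOn).subset ?_
    intro x hx j _
    simpa [Module.Basis.equivFun_apply] using hx j
  refine (Set.Finite.pi (ι := Fin n) fun _ => hbox).subset ?_
  intro a ha i _
  exact ha i

/-- `T ⊆ 𝔬ⁿ` has density `r` with respect to the integral basis `𝔼`:
`|T ∩ O(H, 𝔼)ⁿ| / (2H)^(nk) → r` as `H → ∞`. -/
def HasDensityWrt {K : Type*} [Field K] [NumberField K] {n : ℕ} (E : IntegralBasis K)
    (T : Set (Fin n → 𝓞 K)) (r : ℝ) : Prop :=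
  Filter.Tendsto
    (fun H : ℕ => ((T ∩ boxPow E n H).ncard : ℝ) / (2 * (H : ℝ)) ^ (n * Module.finrank ℚ K))
    Filter.atTop (nhds r)

/-- `ρ(T) = r`: the density of `T ⊆ 𝔬ⁿ` exists with respect to every integral basis,
and is always equal to `r`. -/
def HasDensity {K : Type*} [Field K] [NumberField K] {n : ℕ}
    (T : Set (Fin n → 𝓞 K)) (r : ℝ) : Prop :=
  ∀ E : IntegralBasis K, HasDensityWrt E T r

/-- The polynomial `a₀ + a₁ x + ⋯ + a_d x^d` over `𝔬`, represented by its tuple of coefficients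
`(a₀, …, a_d)`, is `𝔭`-Eisenstein of degree `d`. -/
def IsEisensteinAt {K : Type*} [Field K] [NumberField K] {d : ℕ} (𝔭 : Ideal (𝓞 K))
    (a : Fin (d + 1) → 𝓞 K) : Prop :=
  a (Fin.last d) ∉ 𝔭 ∧ a 0 ∉ 𝔭 ^ 2 ∧ ∀ i : Fin d, a i.castSucc ∈ 𝔭

/-- The set `Γ^d` of Eisenstein polynomials of degree `d` over `𝔬`, as coefficient tuples: those
that are `𝔭`-Eisenstein for some non-zero prime ideal `𝔭`. -/
def eisensteinSet (K : Type*) [Field K] [NumberField K] (d : ℕ) : Set (Fin (d + 1) → 𝓞 K) :=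
  {a | ∃ 𝔭 : Ideal (𝓞 K), 𝔭.IsPrime ∧ 𝔭 ≠ ⊥ ∧ IsEisensteinAt 𝔭 a}

end EisensteinDensity

namespace EisensteinDensity

open IsDedekindDomain

/-! ### Equidistribution of boxes in finite quotients -/

section

variable {K : Type*} [Field K] [NumberField K]

/-! Being `𝔭`-Eisenstein depends only on the coefficients modulo `𝔭²`. For a finite set `S` of
primes, the condition is thus pulled back from a finite quotient group of `𝔬^(d+1)`, over which
boxes equidistribute (`hasDensityWrt_preimage`). By the Chinese remainder theorem the conditions at
different primes are independent, which gives one minus the finite product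
(`hasDensityWrt_exists_mem_finset`).

Passing to all primes needs a tail bound uniform in `H`. Since `d ≥ 2`, a polynomial that is
Eisenstein only at primes outside `S` has `a₀ ≠ 0` and both `a₀` and `a₁` in some `𝔭 ∉ S`, so it
suffices to count such pairs in a box. Let `q` be the rational prime below `𝔭` and `k` the degree of
`K`. If `q ≤ 2H`, the proportion of pairs lying in `𝔭` is at most `4/q²`, and `∑ 1/q²` over all
primes `𝔭` converges because at most `k` of them lie above each `q`. If `q > 2H`, the bound `|N(a₀)|
≤ C H^k` leaves at most `k` such primes for each `a₀`, and each contains at most `(2H)^(k-1)`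
choices of `a₁`; this contributes a proportion `O(1/H)`. Letting first `H` and then `S` grow gives
the density. -/

theorem ncard_box (E : IntegralBasis K) (H : ℕ) :
    (box E H).ncard = (2 * H) ^ Module.finrank ℚ K := by
  have h : box E H = E.equivFun ⁻¹'
      ↑(Fintype.piFinset fun _ : Fin (Module.finrank ℚ K) => Finset.Ico (-(H : ℤ)) (H : ℤ)) := by
    ext x
    simp [box]
  rw [h, Set.ncard_preimage_of_injective_subset_range E.equivFun.injective
    (by rw [E.equivFun.surjective.range_eq]; exact Set.subset_univ _), Set.ncard_coe_finset,
    Fintype.card_piFinset_const, Int.card_Ico]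
  congr 1
  omega

theorem box_finite (E : IntegralBasis K) (H : ℕ) : (box E H).Finite := by
  rcases Nat.eq_zero_or_pos H with rfl | hH
  · have : box E 0 = ∅ := by
      ext x
      have : 0 < Module.finrank ℚ K := Module.finrank_pos
      simp only [box, Set.mem_ofPred_eq, Set.mem_empty_iff_false, iff_false]
      intro h
      simpa using h ⟨0, this⟩
    rw [this]
    exact Set.finite_empty
  · exact Set.finite_of_ncard_pos (by rw [ncard_box]; positivity)

theorem ncard_boxPow (E : IntegralBasis K) (n H : ℕ) :
    (boxPow E n H).ncard = (2 * H) ^ (n * Module.finrank ℚ K) := by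
  classical
  have h : boxPow E n H = ↑(Fintype.piFinset fun _ : Fin n => (box_finite E H).toFinset) := by
    ext x
    simp [boxPow]
  rw [h, Set.ncard_coe_finset, Fintype.card_piFinset_const,
    ← Set.ncard_eq_toFinset_card _ (box_finite E H), ncard_box, ← pow_mul, mul_comm n]

theorem exists_add_mem_boxPow (E : IntegralBasis K) {n : ℕ} (w : Fin n → 𝓞 K) :
    ∃ c : ℕ, ∀ c' ≥ c, ∀ H, ∀ a ∈ boxPow E n H, a + w ∈ boxPow E n (H + c') := by
  refine ⟨∑ i, ∑ j, (E.repr (w i) j).natAbs, fun c' hc' H a ha i j => ?_⟩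
  have h1 : (E.repr (w i) j).natAbs ≤ c' := by
    refine le_trans ?_ hc'
    refine le_trans ?_ (Finset.single_le_sum (f := fun i => ∑ j, (E.repr (w i) j).natAbs)
      (fun _ _ => Nat.zero_le _) (Finset.mem_univ i))
    exact Finset.single_le_sum (f := fun j => (E.repr (w i) j).natAbs)
      (fun _ _ => Nat.zero_le _) (Finset.mem_univ j)
  have h2 := ha i j
  simp only [Set.mem_Ico, Pi.add_apply, map_add, Finsupp.add_apply] at h2 ⊢
  push_cast
  omega

/-- A subset of `𝔬ⁿ` that is pulled back from a finite quotient group has the expected density. -/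
theorem hasDensityWrt_preimage (E : IntegralBasis K) {n : ℕ} {A : Type*} [AddGroup A] [Finite A]
    (φ : (Fin n → 𝓞 K) →+ A) (hφ : Function.Surjective φ) (B : Set A) :
    HasDensityWrt E (φ ⁻¹' B) (B.ncard / Nat.card A) := by
  classical
  have := Fintype.ofFinite A
  set N := n * Module.finrank ℚ K with hN
  let f : A → ℕ → ℕ := fun b H => (φ ⁻¹' {b} ∩ boxPow E n H).ncard
  -- Any two fibres differ by a translation, which carries a box into a slightly larger one. As `A`
  -- is finite, one enlargement `c` serves all pairs of fibres.
  obtain ⟨c, hc⟩ : ∃ c : ℕ, ∀ b b' H, f b H ≤ f b' (H + c) := by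
    choose s hs using hφ
    choose g hg using exists_add_mem_boxPow (K := K) E (n := n)
    refine ⟨∑ b, ∑ b', g (- s b + s b'), fun b b' H => ?_⟩
    refine Set.ncard_le_ncard_of_injOn (fun a => a + (- s b + s b')) ?_
      (fun _ _ _ _ h => by simpa using h) ((boxPow_finite E n _).subset Set.inter_subset_right)
    rintro a ⟨ha, ha'⟩
    refine ⟨?_, hg _ _ ?_ _ _ ha'⟩
    · simp only [Set.mem_preimage, Set.mem_singleton_iff] at ha ⊢
      simp [ha, hs]
    · refine le_trans ?_ (Finset.single_le_sum (f := fun b => ∑ b', g (-s b + s b'))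
        (fun _ _ => Nat.zero_le _) (Finset.mem_univ b))
      exact Finset.single_le_sum (f := fun b' => g (-s b + s b'))
        (fun _ _ => Nat.zero_le _) (Finset.mem_univ b')
  have hunion : ∀ (B : Set A) H, (φ ⁻¹' B ∩ boxPow E n H).ncard = ∑ b ∈ B.toFinset, f b H := by
    intro B H
    have h := Finset.card_eq_sum_card_fiberwise (f := φ)
      (s := ((boxPow_finite E n H).inter_of_right (φ ⁻¹' B)).toFinset) (t := B.toFinset)
      (by intro x hx; simp at hx ⊢; exact hx.1)
    rw [Set.ncard_eq_toFinset_card _ ((boxPow_finite E n H).inter_of_right (φ ⁻¹' B)), h]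
    refine Finset.sum_congr rfl fun b hb => ?_
    rw [← Set.ncard_coe_finset]
    congr 1
    ext x
    simp only [Set.mem_toFinset] at hb
    simp only [Finset.coe_filter, Set.Finite.mem_toFinset, Set.mem_inter_iff, Set.mem_preimage,
      Set.mem_ofPred_eq, Set.mem_singleton_iff]
    constructor
    · rintro ⟨⟨_, h⟩, h'⟩; exact ⟨h', h⟩
    · rintro ⟨h', h⟩; exact ⟨⟨h' ▸ hb, h⟩, h'⟩
  have htot : ∀ H, ∑ b, f b H = (2 * H) ^ N := by
    intro H
    have := hunion Set.univ H
    rw [Set.preimage_univ, Set.univ_inter, ncard_boxPow] at this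
    simpa using this.symm
  -- Summing the comparison over all fibres traps each fibre count between box sizes at `H - c` and
  -- `H + c`, whose ratio to the box at `H` tends to 1.
  have hup : ∀ b H, Fintype.card A * f b H ≤ (2 * (H + c)) ^ N := fun b H => by
    rw [← htot, ← smul_eq_mul, ← Finset.card_univ, ← Finset.sum_const]
    exact Finset.sum_le_sum fun b' _ => hc b b' H
  have hlow : ∀ b H, (2 * H) ^ N ≤ Fintype.card A * f b (H + c) := fun b H => by
    rw [← htot, ← smul_eq_mul, ← Finset.card_univ, ← Finset.sum_const]
    exact Finset.sum_le_sum fun b' _ => hc b' b H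
  have hA : (0 : ℝ) < Fintype.card A := by exact_mod_cast Fintype.card_pos
  have hlim : ∀ z : ℝ, Filter.Tendsto
      (fun H : ℕ => ((2 * ((H : ℝ) + z)) ^ N / (2 * (H : ℝ)) ^ N) / Fintype.card A)
      Filter.atTop (nhds (1 / Fintype.card A)) := by
    intro z
    refine Filter.Tendsto.div_const ?_ _
    have h1 : Filter.Tendsto (fun H : ℕ => (1 + z / (H : ℝ)) ^ N) Filter.atTop (nhds 1) := by
      simpa using ((tendsto_const_div_atTop_nhds_zero_nat z).const_add 1).pow N
    refine h1.congr' ?_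
    filter_upwards [Filter.eventually_gt_atTop 0] with H hH
    have : (H : ℝ) ≠ 0 := by positivity
    rw [← div_pow]
    congr 1
    field_simp
  have hf : ∀ b, Filter.Tendsto (fun H : ℕ => (f b H : ℝ) / (2 * (H : ℝ)) ^ N)
      Filter.atTop (nhds (1 / Fintype.card A)) := by
    intro b
    refine tendsto_of_tendsto_of_tendsto_of_le_of_le' (hlim (-c)) (hlim c) ?_ ?_
    · filter_upwards [Filter.eventually_ge_atTop c] with H hH
      obtain ⟨m, rfl⟩ := Nat.exists_eq_add_of_le' hH
      have h : ((2 * (m : ℝ)) ^ N) ≤ Fintype.card A * f b (m + c) := by exact_mod_cast hlow b m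
      rw [div_right_comm]
      gcongr
      rw [div_le_iff₀ hA]
      push_cast
      simpa [mul_comm] using h
    · filter_upwards with H
      have h : (Fintype.card A * f b H : ℝ) ≤ (2 * ((H : ℝ) + c)) ^ N := by
        exact_mod_cast hup b H
      rw [div_right_comm]
      gcongr
      rw [le_div_iff₀ hA]
      linarith
  unfold HasDensityWrt
  have h := tendsto_finsetSum B.toFinset fun b _ => hf b
  simp only [Finset.sum_const, nsmul_eq_mul] at h
  convert h using 2 with H
  · rw [hunion, ← Finset.sum_div]
    push_cast
    rfl
  · rw [Set.ncard_eq_toFinset_card', Nat.card_eq_fintype_card, mul_one_div]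

end

/-! ### Local densities and finitely many primes -/

section

/-- Independence in a finite product: the complement is the product of the sets `(B i)ᶜ`. -/
theorem ncard_exists_mem_div_card {ι : Type*} [Fintype ι] {X : ι → Type*} [∀ i, Finite (X i)]
    [∀ i, Nonempty (X i)] (B : ∀ i, Set (X i)) :
    ({x : ∀ i, X i | ∃ i, x i ∈ B i}.ncard : ℝ) / Nat.card (∀ i, X i) =
      1 - ∏ i, (1 - ((B i).ncard : ℝ) / Nat.card (X i)) := by
  classical
  have := fun i => Fintype.ofFinite (X i)
  have hX : ∀ i, (Nat.card (X i) : ℝ) ≠ 0 := fun i => by exact_mod_cast Nat.card_pos.ne'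
  have hpi : (Nat.card (∀ i, X i) : ℝ) = ∏ i, (Nat.card (X i) : ℝ) := by
    rw [Nat.card_pi]; push_cast; rfl
  have h0 : ∏ i, (Nat.card (X i) : ℝ) ≠ 0 := Finset.prod_ne_zero_iff.2 fun i _ => hX i
  have hB : ∀ i, 1 - ((B i).ncard : ℝ) / Nat.card (X i) = ((B i)ᶜ.ncard : ℝ) / Nat.card (X i) := by
    intro i
    have h : ((B i).ncard : ℝ) + ((B i)ᶜ.ncard : ℝ) = Nat.card (X i) := by
      exact_mod_cast Set.ncard_add_ncard_compl (B i)
    rw [eq_div_iff (hX i), sub_mul, div_mul_cancel₀ _ (hX i)]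
    linarith
  have hc : {x : ∀ i, X i | ∃ i, x i ∈ B i}ᶜ = ↑(Fintype.piFinset fun i => (B i)ᶜ.toFinset) := by
    ext x
    simp
  have h1 : ({x : ∀ i, X i | ∃ i, x i ∈ B i}.ncard : ℝ) +
      ({x : ∀ i, X i | ∃ i, x i ∈ B i}ᶜ.ncard : ℝ) = Nat.card (∀ i, X i) := by
    exact_mod_cast Set.ncard_add_ncard_compl _
  rw [hc, Set.ncard_coe_finset, Fintype.card_piFinset, hpi] at h1
  simp_rw [hB, Finset.prod_div_distrib]
  rw [hpi, eq_sub_iff_add_eq, ← add_div, div_eq_one_iff_eq h0, ← h1]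
  simp [Set.ncard_eq_toFinset_card']

variable {K : Type*} [Field K]

/-- The image of `𝔭` in `𝔬 / 𝔭²`. -/
def residueIdeal (v : HeightOneSpectrum (𝓞 K)) : Ideal (𝓞 K ⧸ v.asIdeal ^ 2) :=
  v.asIdeal.map (Ideal.Quotient.mk (v.asIdeal ^ 2))

theorem mk_mem_residueIdeal (v : HeightOneSpectrum (𝓞 K)) (x : 𝓞 K) :
    Ideal.Quotient.mk (v.asIdeal ^ 2) x ∈ residueIdeal v ↔ x ∈ v.asIdeal :=
  Ideal.mem_quotient_iff_mem (Ideal.pow_le_self two_ne_zero)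

variable [NumberField K]

theorem finite_quotient_pow (v : HeightOneSpectrum (𝓞 K)) (n : ℕ) :
    Finite (𝓞 K ⧸ v.asIdeal ^ n) :=
  Ideal.finiteQuotientOfFreeOfNeBot _ (pow_ne_zero _ v.ne_bot)

theorem card_quotient_sq (v : HeightOneSpectrum (𝓞 K)) :
    Nat.card (𝓞 K ⧸ v.asIdeal ^ 2) = Ideal.absNorm v.asIdeal ^ 2 := by
  rw [← map_pow]
  rfl

theorem ncard_residueIdeal (v : HeightOneSpectrum (𝓞 K)) :
    (residueIdeal v : Set (𝓞 K ⧸ v.asIdeal ^ 2)).ncard = Ideal.absNorm v.asIdeal := by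
  have hpos : 0 < Ideal.absNorm v.asIdeal :=
    Nat.pos_of_ne_zero (by simpa [Ideal.absNorm_eq_zero_iff] using v.ne_bot)
  have h := Submodule.card_eq_card_quotient_mul_card (residueIdeal v)
  have h2 : Nat.card ((𝓞 K ⧸ v.asIdeal ^ 2) ⧸ residueIdeal v) = Ideal.absNorm v.asIdeal :=
    Nat.card_congr (DoubleQuot.quotQuotEquivQuotOfLE
      (Ideal.pow_le_self (I := v.asIdeal) two_ne_zero)).toEquiv
  rw [card_quotient_sq, h2, sq] at h
  rw [← Nat.card_coe_set_eq]
  first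
  | exact (Nat.eq_of_mul_eq_mul_left hpos h).symm
  | exact (Nat.eq_of_mul_eq_mul_right hpos h).symm

/-- Tuples in `𝔬 / 𝔭²` satisfying the Eisenstein conditions. -/
def residueEisenstein (d : ℕ) (v : HeightOneSpectrum (𝓞 K)) :
    Set (Fin (d + 1) → 𝓞 K ⧸ v.asIdeal ^ 2) :=
  {b | b (Fin.last d) ∉ residueIdeal v ∧ b 0 ≠ 0 ∧ ∀ i : Fin d, b i.castSucc ∈ residueIdeal v}

theorem mk_mem_residueEisenstein {d : ℕ} (v : HeightOneSpectrum (𝓞 K)) (a : Fin (d + 1) → 𝓞 K) :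
    (fun i => Ideal.Quotient.mk (v.asIdeal ^ 2) (a i)) ∈ residueEisenstein d v ↔
      IsEisensteinAt v.asIdeal a := by
  simp only [residueEisenstein, IsEisensteinAt, Set.mem_ofPred_eq, mk_mem_residueIdeal, ne_eq,
    Ideal.Quotient.eq_zero_iff_mem]

/-- With `N` the norm of `𝔭`, its image in the `N²` residues modulo `𝔭²` has `N` elements. This
leaves `N - 1` choices for `a₀`, `N` for each middle coefficient and `N² - N` for `a_d`; `d ≥ 1`
keeps `a₀` and `a_d` distinct. -/
theorem ncard_residueEisenstein {d : ℕ} (hd : 1 ≤ d) (v : HeightOneSpectrum (𝓞 K)) :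
    ((residueEisenstein d v).ncard : ℝ) / Nat.card (Fin (d + 1) → 𝓞 K ⧸ v.asIdeal ^ 2) =
      ((Ideal.absNorm v.asIdeal : ℝ) - 1) ^ 2 / (Ideal.absNorm v.asIdeal : ℝ) ^ (d + 2) := by
  classical
  obtain ⟨e, rfl⟩ := Nat.exists_eq_add_of_le' hd
  have := finite_quotient_pow v 2
  have := Fintype.ofFinite (𝓞 K ⧸ v.asIdeal ^ 2)
  set R := 𝓞 K ⧸ v.asIdeal ^ 2
  set N := Ideal.absNorm v.asIdeal with hN
  have hpos : 0 < N := Nat.pos_of_ne_zero (by simpa [hN, Ideal.absNorm_eq_zero_iff] using v.ne_bot)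
  let V : Finset R := (residueIdeal v : Set R).toFinset
  have hV : V.card = N := by
    rw [hN, ← ncard_residueIdeal v, Set.ncard_eq_toFinset_card']
  have hset : residueEisenstein (e + 1) v = ↑(Fintype.piFinset
      (Fin.snoc (α := fun _ => Finset R)
        (Fin.cons (α := fun _ => Finset R) (V.erase 0) (fun _ : Fin e => V)) Vᶜ)) := by
    ext b
    rw [Finset.mem_coe, Fintype.mem_piFinset, Fin.forall_fin_succ', Fin.snoc_last]
    simp only [Fin.snoc_castSucc, residueEisenstein, Set.mem_ofPred_eq]
    rw [Fin.forall_fin_succ, Fin.forall_fin_succ]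
    simp only [Fin.cons_zero, Fin.cons_succ, Fin.castSucc_zero]
    simp only [V, Finset.mem_compl, Finset.mem_erase, Set.mem_toFinset, SetLike.mem_coe]
    tauto
  have hcard : (residueEisenstein (e + 1) v).ncard = (N - 1) * N ^ e * (N ^ 2 - N) := by
    rw [hset, Set.ncard_coe_finset, Fintype.card_piFinset, Fin.prod_univ_castSucc]
    simp only [Fin.snoc_last, Fin.snoc_castSucc, Fin.prod_univ_succ, Fin.cons_zero, Fin.cons_succ]
    rw [Finset.card_compl, Finset.card_erase_of_mem (by simp [V]), Finset.prod_const, hV,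
      ← Nat.card_eq_fintype_card, card_quotient_sq, Finset.card_univ, Fintype.card_fin]
  rw [hcard, Nat.card_fun, card_quotient_sq, ← hN, Nat.card_fin]
  have h1 : N ≤ N ^ 2 := by nlinarith
  have h2 : (N : ℝ) ≠ 0 := by positivity
  push_cast [h1, Nat.cast_sub hpos]
  field_simp
  ring

theorem hasDensityWrt_exists_mem_finset (E : IntegralBasis K) {d : ℕ} (hd : 1 ≤ d)
    (S : Finset (HeightOneSpectrum (𝓞 K))) :
    HasDensityWrt E {a : Fin (d + 1) → 𝓞 K | ∃ v ∈ S, IsEisensteinAt v.asIdeal a}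
      (1 - ∏ v ∈ S, (1 - ((Ideal.absNorm v.asIdeal : ℝ) - 1) ^ 2 /
        (Ideal.absNorm v.asIdeal : ℝ) ^ (d + 2))) := by
  have := fun v : S => finite_quotient_pow (v : HeightOneSpectrum (𝓞 K)) 2
  let φ : (Fin (d + 1) → 𝓞 K) →+ (∀ v : S, Fin (d + 1) → 𝓞 K ⧸ v.1.asIdeal ^ 2) :=
    { toFun := fun a v i => Ideal.Quotient.mk _ (a i)
      map_zero' := by ext; simp
      map_add' := fun _ _ => by ext; simp }
  have hφ : Function.Surjective φ := by
    intro b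
    have hco : Pairwise (Function.onFun IsCoprime fun v : S => v.1.asIdeal ^ 2) := fun v w h =>
      HeightOneSpectrum.isCoprime_pow_of_ne _ _ (fun h' => h (Subtype.ext h')) _ _
    choose a ha using fun i => Ideal.pi_quotient_surjective hco fun v => b v i
    exact ⟨a, funext fun v => funext fun i => ha i v⟩
  have h := hasDensityWrt_preimage E φ hφ {b | ∃ v : S, b v ∈ residueEisenstein d v.1}
  rw [ncard_exists_mem_div_card] at h
  simp_rw [ncard_residueEisenstein hd] at h
  rw [Finset.prod_coe_sort S (fun v => 1 - ((Ideal.absNorm v.asIdeal : ℝ) - 1) ^ 2 /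
        (Ideal.absNorm v.asIdeal : ℝ) ^ (d + 2))] at h
  convert h using 1
  ext a
  simp only [Set.mem_ofPred_eq, Set.mem_preimage, Subtype.exists]
  simp_rw [← mk_mem_residueEisenstein]
  simp only [← exists_prop]
  rfl

end

/-! ### Counting elements of primes in boxes, and primes containing an element -/

section

variable {K : Type*} [Field K]

/-- The rational prime below `𝔭`. -/
noncomputable def primeBelow (v : HeightOneSpectrum (𝓞 K)) : ℕ :=
  Ideal.absNorm (v.asIdeal.under ℤ)

theorem intCast_mem_iff (v : HeightOneSpectrum (𝓞 K)) (z : ℤ) :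
    (z : 𝓞 K) ∈ v.asIdeal ↔ (primeBelow v : ℤ) ∣ z :=
  Int.cast_mem_ideal_iff

theorem prime_primeBelow (v : HeightOneSpectrum (𝓞 K)) : (primeBelow v).Prime :=
  have : NeZero v.asIdeal := ⟨v.ne_bot⟩
  Nat.absNorm_under_prime v.asIdeal

variable [NumberField K]

theorem absNorm_pos (v : HeightOneSpectrum (𝓞 K)) : 0 < Ideal.absNorm v.asIdeal :=
  Nat.pos_of_ne_zero (by simpa [Ideal.absNorm_eq_zero_iff] using v.ne_bot)

theorem primeBelow_le_absNorm (v : HeightOneSpectrum (𝓞 K)) :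
    primeBelow v ≤ Ideal.absNorm v.asIdeal :=
  Nat.le_of_dvd (absNorm_pos v) (Int.absNorm_under_dvd_absNorm v.asIdeal)

/-- Some basis element `e_j` is not in `𝔭`, since otherwise `1 ∈ 𝔭`. Once the other coordinates are
fixed, membership in `𝔭` determines the `j`-th one modulo `q`, so the quotient of `a_j + H ∈ [0,
2H)` by `q` identifies the element. -/
theorem ncard_inter_box_le (E : IntegralBasis K) (v : HeightOneSpectrum (𝓞 K)) (H : ℕ) :
    ((v.asIdeal : Set (𝓞 K)) ∩ box E H).ncard ≤
      (2 * H) ^ (Module.finrank ℚ K - 1) * (2 * H / primeBelow v + 1) := by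
  classical
  obtain ⟨j, hj⟩ : ∃ j, E j ∉ v.asIdeal := by
    by_contra! h
    refine v.isPrime.ne_top ((Ideal.eq_top_iff_one _).2 ?_)
    rw [← E.sum_repr 1]
    exact Ideal.sum_mem _ fun i _ => Submodule.smul_of_tower_mem _ _ (h i)
  set q := primeBelow v with hq
  have hq0 : (0 : ℤ) < q := by exact_mod_cast (prime_primeBelow v).pos
  let F : Finset (({i // i ≠ j} → ℤ) × ℤ) :=
    (Fintype.piFinset fun _ => Finset.Ico (-(H : ℤ)) H) ×ˢ Finset.Ico 0 (2 * H / q + 1 : ℤ)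
  have hF : F.card = (2 * H) ^ (Module.finrank ℚ K - 1) * (2 * H / q + 1) := by
    rw [Finset.card_product, Fintype.card_piFinset, Finset.prod_const, Int.card_Ico,
      Int.card_Ico]
    congr 1
    · congr 1
      · omega
      · simp
  rw [← hF, ← Set.ncard_coe_finset]
  refine Set.ncard_le_ncard_of_injOn
    (fun x => (fun i : {i // i ≠ j} => E.repr x i, (E.repr x j + H) / q)) ?_ ?_ F.finite_toSet
  · rintro x ⟨-, hx⟩
    have hxj := hx j
    simp only [Set.mem_Ico] at hxj
    simp only [F, Finset.coe_product, Set.mem_prod, Finset.mem_coe, Fintype.mem_piFinset,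
      Finset.mem_Ico]
    refine ⟨fun i => by simpa using hx i, Int.ediv_nonneg (by omega) hq0.le, ?_⟩
    have : (E.repr x j + H) / (q : ℤ) ≤ 2 * H / q := Int.ediv_le_ediv hq0 (by omega)
    omega
  · rintro x ⟨hx, -⟩ y ⟨hy, -⟩ hxy
    simp only [Prod.mk.injEq, funext_iff, Subtype.forall] at hxy
    obtain ⟨h1, h2⟩ := hxy
    have hsub : x - y = (E.repr x j - E.repr y j) • E j := by
      conv_lhs => rw [← E.sum_repr (x - y)]
      rw [Finset.sum_eq_single j]
      · simp
      · intro i _ hi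
        simp [h1 i hi]
      · simp
    have hmem : ((E.repr x j - E.repr y j : ℤ) : 𝓞 K) ∈ v.asIdeal := by
      have h := v.asIdeal.sub_mem hx hy
      rw [hsub, zsmul_eq_mul] at h
      exact (v.isPrime.mem_or_mem h).resolve_right hj
    rw [intCast_mem_iff, ← hq] at hmem
    obtain ⟨t, ht⟩ := hmem
    have h3 : E.repr x j + H = E.repr y j + H + q * t := by linarith
    rw [h3, Int.add_mul_ediv_left _ _ hq0.ne'] at h2
    have h4 : t = 0 := by omega
    rw [h4, mul_zero] at ht
    rw [ht, zero_smul, sub_eq_zero] at hsub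
    exact hsub

/-- The product of the distinct primes in `S` divides `(x)`, and each has norm at least `m`. -/
theorem pow_card_le_absNorm_span {x : 𝓞 K} (hx : x ≠ 0) (S : Finset (HeightOneSpectrum (𝓞 K)))
    (hS : ∀ v ∈ S, x ∈ v.asIdeal) {m : ℕ} (hm : ∀ v ∈ S, m ≤ primeBelow v) :
    m ^ S.card ≤ Ideal.absNorm (Ideal.span {x}) := by
  classical
  have hdvd : ∏ v ∈ S, v.asIdeal ∣ Ideal.span {x} := by
    have := Finset.prod_primes_dvd (s := S.image HeightOneSpectrum.asIdeal) (Ideal.span {x})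
      (by simpa using fun v _ => v.prime)
      (by simpa [Ideal.dvd_span_singleton] using hS)
    rwa [Finset.prod_image fun v _ w _ h => HeightOneSpectrum.ext h] at this
  have h0 : Ideal.absNorm (Ideal.span {x}) ≠ 0 := by
    simpa [Ideal.absNorm_eq_zero_iff] using hx
  refine le_trans ?_ (Nat.le_of_dvd (Nat.pos_of_ne_zero h0) (map_dvd Ideal.absNorm hdvd))
  rw [map_prod]
  exact Finset.pow_card_le_prod _ _ _ fun v hv => (hm v hv).trans (primeBelow_le_absNorm v)

theorem card_le_finrank_of_primeBelow_eq (S : Finset (HeightOneSpectrum (𝓞 K))) {p : ℕ}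
    (hS : ∀ v ∈ S, primeBelow v = p) : S.card ≤ Module.finrank ℚ K := by
  rcases S.eq_empty_or_nonempty with rfl | ⟨w, hw⟩
  · simp
  have hp : p.Prime := hS w hw ▸ prime_primeBelow w
  -- The norm of `(p)` is `p^k`, so comparing exponents bounds the number of primes above `p`.
  have h := pow_card_le_absNorm_span (x := (p : 𝓞 K)) (by exact_mod_cast hp.ne_zero) S
    (fun v hv => by exact_mod_cast (intCast_mem_iff v p).2 (by rw [hS v hv]))
    (fun v hv => (hS v hv).ge)
  rw [Ideal.absNorm_span_natCast, NumberField.RingOfIntegers.rank] at h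
  exact (Nat.pow_le_pow_iff_right hp.one_lt).1 h

theorem summable_one_div_primeBelow_sq :
    Summable fun v : HeightOneSpectrum (𝓞 K) => 1 / (primeBelow v : ℝ) ^ 2 := by
  classical
  have hs : Summable fun n : ℕ => 1 / (n : ℝ) ^ 2 :=
    Real.summable_one_div_nat_pow.2 one_lt_two
  refine summable_of_sum_le (c := Module.finrank ℚ K * ∑' n : ℕ, 1 / (n : ℝ) ^ 2)
    (fun v => by positivity) fun S => ?_
  rw [Finset.sum_comp (fun n : ℕ => 1 / (n : ℝ) ^ 2) primeBelow]
  calc _ ≤ ∑ n ∈ S.image primeBelow, (Module.finrank ℚ K : ℝ) * (1 / (n : ℝ) ^ 2) := by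
        refine Finset.sum_le_sum fun n _ => ?_
        rw [nsmul_eq_mul]
        gcongr
        exact card_le_finrank_of_primeBelow_eq _ fun v hv => (Finset.mem_filter.1 hv).2
    _ ≤ _ := by
        rw [← Finset.mul_sum]
        gcongr
        exact hs.sum_le_tsum _ fun _ _ => by positivity

theorem finite_setOf_mem {x : 𝓞 K} (hx : x ≠ 0) :
    {v : HeightOneSpectrum (𝓞 K) | x ∈ v.asIdeal}.Finite := by
  have := Ideal.finite_factors (I := Ideal.span {x}) (by simpa using hx)
  simpa [Ideal.dvd_span_singleton] using this

theorem finite_setOf_primeBelow_le (n : ℕ) :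
    {v : HeightOneSpectrum (𝓞 K) | primeBelow v ≤ n}.Finite := by
  refine ((Finset.Icc 1 n).finite_toSet.biUnion fun m hm =>
    finite_setOf_mem (K := K) (x := (m : 𝓞 K)) ?_).subset fun v hv => ?_
  · simp at hm
    exact_mod_cast (show m ≠ 0 by omega)
  · simp only [Set.mem_iUnion, Set.mem_ofPred_eq]
    refine ⟨primeBelow v, ?_, ?_⟩
    · simpa using ⟨(prime_primeBelow v).pos, hv⟩
    · exact_mod_cast (intCast_mem_iff v (primeBelow v)).2 dvd_rfl

/-- The norm is a form of degree `k` in the coordinates, so `(2H)^|S| ≤ |N(x)| ≤ C H^k`, which is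
below `(2H)^(k+1)` as soon as `C < 2H`. -/
theorem exists_card_le_of_mem_box (E : IntegralBasis K) :
    ∃ C : ℕ, ∀ H ≥ C, ∀ x ∈ box E H, x ≠ 0 → ∀ S : Finset (HeightOneSpectrum (𝓞 K)),
      (∀ v ∈ S, x ∈ v.asIdeal ∧ 2 * H < primeBelow v) → S.card ≤ Module.finrank ℚ K := by
  obtain ⟨C, hC⟩ : ∃ C : ℕ, (C : ℤ) = ClassGroup.normBound AbsoluteValue.abs E :=
    Int.eq_ofNat_of_zero_le (ClassGroup.normBound_pos _ E).le |>.imp fun _ h => h.symm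
  refine ⟨C + 1, fun H hH x hx hx0 S hS => ?_⟩
  have h1 := ClassGroup.norm_le AbsoluteValue.abs E x (y := H) fun j => by
    have := hx j
    simp only [Set.mem_Ico] at this
    rw [AbsoluteValue.abs_apply, abs_le]
    omega
  have h2 := pow_card_le_absNorm_span hx0 S (fun v hv => (hS v hv).1) (m := 2 * H)
    fun v hv => (hS v hv).2.le
  rw [← hC, Fintype.card_fin, AbsoluteValue.abs_apply] at h1
  rw [Ideal.absNorm_span_singleton] at h2
  have h3 : (Algebra.norm ℤ x).natAbs ≤ C * H ^ Module.finrank ℚ K := by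
    zify
    exact h1
  have h4 : C * H ^ Module.finrank ℚ K < (2 * H) ^ (Module.finrank ℚ K + 1) := by
    rw [pow_succ']
    have : 0 < H := by omega
    refine Nat.mul_lt_mul_of_lt_of_le (by omega) (Nat.pow_le_pow_left (by omega) _) (by positivity)
  exact Nat.lt_succ_iff.1 ((Nat.pow_lt_pow_iff_right (by omega)).1 ((h2.trans h3).trans_lt h4))

end

/-! ### The tail estimate and the passage to all primes -/

section

variable {K : Type*} [Field K] [NumberField K]

theorem eisensteinSet_eq (d : ℕ) : eisensteinSet K d =
    {a | ∃ v : HeightOneSpectrum (𝓞 K), IsEisensteinAt v.asIdeal a} := by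
  ext a
  exact ⟨fun ⟨p, h1, h2, h3⟩ => ⟨⟨p, h1, h2⟩, h3⟩, fun ⟨v, h⟩ => ⟨_, v.isPrime, v.ne_bot, h⟩⟩

/-- Pairs in a box whose first entry is non-zero and which lie in a common prime outside `S`. -/
def commonPrimePairs (E : IntegralBasis K) (S : Finset (HeightOneSpectrum (𝓞 K))) (H : ℕ) :
    Set (𝓞 K × 𝓞 K) :=
  {x | x.1 ∈ box E H ∧ x.2 ∈ box E H ∧ x.1 ≠ 0 ∧ ∃ v ∉ S, x.1 ∈ v.asIdeal ∧ x.2 ∈ v.asIdeal}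

theorem commonPrimePairs_finite (E : IntegralBasis K) (S : Finset (HeightOneSpectrum (𝓞 K)))
    (H : ℕ) : (commonPrimePairs E S H).Finite :=
  ((box_finite E H).prod (box_finite E H)).subset fun _ hx => ⟨hx.1, hx.2.1⟩

open Classical in
theorem exists_ncard_commonPrimePairs_le (E : IntegralBasis K) : ∃ C : ℕ, ∀ H ≥ C, ∀ S,
    (commonPrimePairs E S H).ncard ≤
      ∑ v ∈ (finite_setOf_primeBelow_le (K := K) (2 * H)).toFinset.filter (· ∉ S),
        ((v.asIdeal : Set (𝓞 K)) ∩ box E H).ncard ^ 2 +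
      (2 * H) ^ Module.finrank ℚ K *
        (Module.finrank ℚ K * (2 * H) ^ (Module.finrank ℚ K - 1)) := by
  classical
  obtain ⟨C, hC⟩ := exists_card_le_of_mem_box E
  refine ⟨C, fun H hH S => ?_⟩
  have hfin : ∀ v : HeightOneSpectrum (𝓞 K), ((v.asIdeal : Set (𝓞 K)) ∩ box E H).Finite :=
    fun v => (box_finite E H).inter_of_right _
  let A : HeightOneSpectrum (𝓞 K) → Finset (𝓞 K) := fun v => (hfin v).toFinset
  have hA : ∀ v, (A v).card = ((v.asIdeal : Set (𝓞 K)) ∩ box E H).ncard := fun v =>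
    (Set.ncard_eq_toFinset_card _ (hfin v)).symm
  let P := (finite_setOf_primeBelow_le (K := K) (2 * H)).toFinset.filter (· ∉ S)
  let X : Finset (𝓞 K) := (box_finite E H).toFinset
  -- The large primes containing `x`. Zero lies in every prime, so it gets the empty set; it never
  -- occurs as a first entry.
  let Q : 𝓞 K → Finset (HeightOneSpectrum (𝓞 K)) := fun x =>
    if hx : x = 0 then ∅ else
      (finite_setOf_mem hx).toFinset.filter fun v => 2 * H < primeBelow v
  have hQ : ∀ x ∈ X, (Q x).card ≤ Module.finrank ℚ K := by
    intro x hx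
    by_cases h : x = 0
    · simp [Q, h]
    · refine hC H hH x (by simpa [X] using hx) h _ fun v hv => ?_
      simpa [Q, h] using hv
  have hsub : (commonPrimePairs_finite E S H).toFinset ⊆
      (P.biUnion fun v => A v ×ˢ A v) ∪
        X.biUnion fun x => (Q x).biUnion fun v => {x} ×ˢ A v := by
    rintro ⟨x, y⟩ hxy
    rw [Set.Finite.mem_toFinset] at hxy
    obtain ⟨hx, hy, hx0, v, hv, hxv, hyv⟩ := hxy
    rw [Finset.mem_union]
    rcases le_or_gt (primeBelow v) (2 * H) with h | h
    · left
      rw [Finset.mem_biUnion]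
      refine ⟨v, ?_, ?_⟩
      · simp [P, h, hv]
      · simp [A, hxv, hyv, hx, hy]
    · right
      rw [Finset.mem_biUnion]
      refine ⟨x, by simpa [X] using hx, Finset.mem_biUnion.2 ⟨v, ?_, ?_⟩⟩
      · simp only [Q, hx0, dite_false]
        simp [h, hxv]
      · simp [A, hyv, hy]
  rw [Set.ncard_eq_toFinset_card _ (commonPrimePairs_finite E S H)]
  refine (Finset.card_le_card hsub).trans ((Finset.card_union_le _ _).trans (add_le_add ?_ ?_))
  · refine Finset.card_biUnion_le.trans (Finset.sum_le_sum fun v _ => ?_)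
    rw [Finset.card_product, hA, sq]
  · have hX : X.card = (2 * H) ^ Module.finrank ℚ K := by
      rw [← ncard_box E, Set.ncard_eq_toFinset_card _ (box_finite E H)]
    rw [← hX]
    refine Finset.card_biUnion_le_card_mul _ _ _ fun x hx => ?_
    refine (Finset.card_biUnion_le_card_mul _ _ ((2 * H) ^ (Module.finrank ℚ K - 1))
      fun v hv => ?_).trans (Nat.mul_le_mul_right _ (hQ x hx))
    have hv : 2 * H < primeBelow v := by
      by_cases h : x = 0
      · simp [Q, h] at hv
      · simp only [Q, h, dite_false, Finset.mem_filter] at hv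
        exact hv.2
    rw [Finset.card_product, Finset.card_singleton, one_mul, hA]
    -- For `q > 2H` the factor `2H / q + 1` is 1.
    simpa [Nat.div_eq_of_lt hv] using ncard_inter_box_le E v H

/-- For `q ≤ 2H` the extra `1` is absorbed by `2H / q ≥ 1`, at the cost of a factor 2. -/
theorem ncard_inter_box_le_div (E : IntegralBasis K) (v : HeightOneSpectrum (𝓞 K)) {H : ℕ}
    (hv : primeBelow v ≤ 2 * H) : (((v.asIdeal : Set (𝓞 K)) ∩ box E H).ncard : ℝ) ≤
      2 * (2 * (H : ℝ)) ^ Module.finrank ℚ K / primeBelow v := by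
  have hq : (0 : ℝ) < primeBelow v := by exact_mod_cast (prime_primeBelow v).pos
  have h1 : (((v.asIdeal : Set (𝓞 K)) ∩ box E H).ncard : ℝ) ≤
      (2 * (H : ℝ)) ^ (Module.finrank ℚ K - 1) * ((2 * H / primeBelow v : ℕ) + 1) := by
    exact_mod_cast ncard_inter_box_le E v H
  have h2 : ((2 * H / primeBelow v : ℕ) : ℝ) ≤ 2 * H / primeBelow v := by
    exact_mod_cast (Nat.cast_div_le (α := ℝ) (m := 2 * H) (n := primeBelow v))
  have h3 : (1 : ℝ) ≤ 2 * H / primeBelow v := by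
    rw [one_le_div hq]
    exact_mod_cast hv
  refine h1.trans ?_
  have hk : Module.finrank ℚ K - 1 + 1 = Module.finrank ℚ K :=
    Nat.sub_add_cancel Module.finrank_pos
  calc _ ≤ (2 * (H : ℝ)) ^ (Module.finrank ℚ K - 1) * (2 * (2 * H / primeBelow v)) := by
        gcongr
        linarith
    _ = _ := by
        conv_rhs => rw [← hk, pow_succ]
        ring

/-- The threshold `C` does not depend on `S`, and the main term is a tail of a convergent series,
free of `H`. -/
theorem exists_ncard_commonPrimePairs_div_le (E : IntegralBasis K) : ∃ C : ℕ, ∀ H ≥ C, ∀ S,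
    ((commonPrimePairs E S H).ncard : ℝ) / (2 * (H : ℝ)) ^ (2 * Module.finrank ℚ K) ≤
      4 * (∑' v : HeightOneSpectrum (𝓞 K), 1 / (primeBelow v : ℝ) ^ 2 -
        ∑ v ∈ S, 1 / (primeBelow v : ℝ) ^ 2) + Module.finrank ℚ K / (2 * (H : ℝ)) := by
  classical
  obtain ⟨C, hC⟩ := exists_ncard_commonPrimePairs_le E
  refine ⟨C + 1, fun H hH S => ?_⟩
  have hH0 : (0 : ℝ) < H := by exact_mod_cast (show 0 < H by omega)
  set k := Module.finrank ℚ K with hk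
  set P := (finite_setOf_primeBelow_le (K := K) (2 * H)).toFinset.filter (· ∉ S) with hP
  have h1 : ((commonPrimePairs E S H).ncard : ℝ) ≤
      ∑ v ∈ P, (((v.asIdeal : Set (𝓞 K)) ∩ box E H).ncard : ℝ) ^ 2 +
        (2 * (H : ℝ)) ^ k * (k * (2 * (H : ℝ)) ^ (k - 1)) := by
    exact_mod_cast hC H (by omega) S
  have h2 : ∑ v ∈ P, (((v.asIdeal : Set (𝓞 K)) ∩ box E H).ncard : ℝ) ^ 2 ≤
      ∑ v ∈ P, 4 * (2 * (H : ℝ)) ^ (2 * k) * (1 / (primeBelow v : ℝ) ^ 2) := by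
    refine Finset.sum_le_sum fun v hv => ?_
    have hv' : primeBelow v ≤ 2 * H := by
      simpa using (Finset.mem_filter.1 hv).1
    calc _ ≤ (2 * (2 * (H : ℝ)) ^ k / primeBelow v) ^ 2 := by
          gcongr
          exact ncard_inter_box_le_div E v hv'
      _ = _ := by
          rw [mul_comm 2 k, pow_mul]
          ring
  have h3 : ∑ v ∈ P, 1 / (primeBelow v : ℝ) ^ 2 + ∑ v ∈ S, 1 / (primeBelow v : ℝ) ^ 2 ≤
      ∑' v : HeightOneSpectrum (𝓞 K), 1 / (primeBelow v : ℝ) ^ 2 := by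
    rw [← Finset.sum_union (Finset.disjoint_left.2 fun v hv => (Finset.mem_filter.1 hv).2)]
    exact summable_one_div_primeBelow_sq.sum_le_tsum _ fun _ _ => by positivity
  rw [← Finset.mul_sum] at h2
  have h4 : (2 * (H : ℝ)) ^ k * (k * (2 * (H : ℝ)) ^ (k - 1)) =
      k / (2 * (H : ℝ)) * (2 * (H : ℝ)) ^ (2 * k) := by
    have hk1 : k - 1 + 1 = k := Nat.sub_add_cancel Module.finrank_pos
    have h5 : (2 * (H : ℝ)) ^ (2 * k) =
        (2 * (H : ℝ)) ^ k * (2 * (H : ℝ)) ^ (k - 1) * (2 * (H : ℝ)) := by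
      rw [mul_assoc, ← pow_succ, hk1, ← pow_add, two_mul k]
    rw [h5]
    field_simp
  rw [div_le_iff₀ (by positivity), add_mul]
  rw [h4] at h1
  refine h1.trans (add_le_add_left (h2.trans ?_) _)
  rw [mul_right_comm]
  gcongr
  linarith

theorem exists_ncard_eisensteinSet_diff_le (E : IntegralBasis K) {d : ℕ} (hd : 2 ≤ d) :
    ∃ C : ℕ, ∀ H ≥ C, ∀ S : Finset (HeightOneSpectrum (𝓞 K)),
    (((eisensteinSet K d ∩ boxPow E (d + 1) H).ncard : ℝ) -
      ({a : Fin (d + 1) → 𝓞 K | ∃ v ∈ S, IsEisensteinAt v.asIdeal a} ∩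
        boxPow E (d + 1) H).ncard) / (2 * (H : ℝ)) ^ ((d + 1) * Module.finrank ℚ K) ≤
      4 * (∑' v : HeightOneSpectrum (𝓞 K), 1 / (primeBelow v : ℝ) ^ 2 -
        ∑ v ∈ S, 1 / (primeBelow v : ℝ) ^ 2) + Module.finrank ℚ K / (2 * (H : ℝ)) := by
  obtain ⟨e, rfl⟩ := Nat.exists_eq_add_of_le' hd
  obtain ⟨C, hC⟩ := exists_ncard_commonPrimePairs_div_le E
  refine ⟨C + 1, fun H hH S => le_trans ?_ (hC H (by omega) S)⟩
  have hH0 : (0 : ℝ) < H := by exact_mod_cast (show 0 < H by omega)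
  set T := {a : Fin (e + 2 + 1) → 𝓞 K | ∃ v ∈ S, IsEisensteinAt v.asIdeal a}
  set W := (eisensteinSet K (e + 2) ∩ boxPow E (e + 2 + 1) H) \ (T ∩ boxPow E (e + 2 + 1) H)
  have h1 : (eisensteinSet K (e + 2) ∩ boxPow E (e + 2 + 1) H).ncard ≤
      W.ncard + (T ∩ boxPow E (e + 2 + 1) H).ncard :=
    Set.ncard_le_ncard_sdiff_add_ncard _ _ ((boxPow_finite E _ H).inter_of_right _)
  have h2 : W.ncard ≤ (commonPrimePairs E S H).ncard * (boxPow E (e + 1) H).ncard := by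
    rw [← Set.ncard_prod]
    -- Only `a₀` and `a₁` are constrained; the other `d - 1` coefficients range freely. Here `a₀ ≠
    -- 0` because `0 ∈ 𝔭²`.
    refine Set.ncard_le_ncard_of_injOn (fun a => ((a 0, a 1), fun i => a i.succ.succ)) ?_ ?_
      ((commonPrimePairs_finite E S H).prod (boxPow_finite E _ H))
    · rintro a ⟨⟨ha, hbox⟩, haT⟩
      rw [eisensteinSet_eq] at ha
      obtain ⟨v, hv⟩ := ha
      refine ⟨⟨hbox 0, hbox 1, fun h => hv.2.1 ?_, v, fun hvS => haT ⟨⟨v, hvS, hv⟩, hbox⟩,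
        hv.2.2 0, hv.2.2 1⟩, fun i => hbox _⟩
      simp only at h
      rw [h]
      exact zero_mem _
    · intro a _ b _ hab
      simp only [Prod.mk.injEq, funext_iff] at hab
      funext i
      refine Fin.cases hab.1.1 (fun i => ?_) i
      exact Fin.cases hab.1.2 (fun i => hab.2 i) i
  rw [ncard_boxPow] at h2
  have h3 : ((eisensteinSet K (e + 2) ∩ boxPow E (e + 2 + 1) H).ncard : ℝ) ≤
      W.ncard + (T ∩ boxPow E (e + 2 + 1) H).ncard := by exact_mod_cast h1
  have h4 : (W.ncard : ℝ) ≤ (commonPrimePairs E S H).ncard *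
      (2 * (H : ℝ)) ^ ((e + 1) * Module.finrank ℚ K) := by exact_mod_cast h2
  rw [div_le_div_iff₀ (by positivity) (by positivity)]
  have h5 : (2 * (H : ℝ)) ^ ((e + 2 + 1) * Module.finrank ℚ K) =
      (2 * (H : ℝ)) ^ ((e + 1) * Module.finrank ℚ K) *
        (2 * (H : ℝ)) ^ (2 * Module.finrank ℚ K) := by
    rw [← pow_add]
    ring_nf
  rw [h5, ← mul_assoc]
  gcongr
  linarith

theorem multipliable_eisenstein_factor {d : ℕ} (hd : 2 ≤ d) :
    Multipliable (fun v : HeightOneSpectrum (𝓞 K) =>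
      1 - ((Ideal.absNorm v.asIdeal : ℝ) - 1) ^ 2 / (Ideal.absNorm v.asIdeal : ℝ) ^ (d + 2)) := by
  simp_rw [sub_eq_add_neg (1 : ℝ)]
  refine multipliable_one_add_of_summable ?_
  refine summable_one_div_primeBelow_sq.of_nonneg_of_le (fun v => norm_nonneg _) fun v => ?_
  have h1 : (1 : ℝ) ≤ Ideal.absNorm v.asIdeal := by exact_mod_cast absNorm_pos v
  have h2 : (primeBelow v : ℝ) ≤ Ideal.absNorm v.asIdeal := by
    exact_mod_cast primeBelow_le_absNorm v
  have h3 : (0 : ℝ) < primeBelow v := by exact_mod_cast (prime_primeBelow v).pos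
  set N : ℝ := (Ideal.absNorm v.asIdeal : ℝ)
  rw [norm_neg, Real.norm_of_nonneg (by positivity)]
  calc (N + -1) ^ 2 / N ^ (d + 2) ≤ N ^ 2 / N ^ (d + 2) := by
        gcongr
        · linarith
        · linarith
    _ = 1 / N ^ d := by
        rw [pow_add]
        field_simp
    _ ≤ 1 / N ^ 2 := by
        gcongr
    _ ≤ _ := by gcongr

theorem hasDensity_eisensteinSet {d : ℕ} (hd : 2 ≤ d) :
    HasDensity (eisensteinSet K d) (1 - ∏' v : HeightOneSpectrum (𝓞 K),
      (1 - ((Ideal.absNorm v.asIdeal : ℝ) - 1) ^ 2 /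
        (Ideal.absNorm v.asIdeal : ℝ) ^ (d + 2))) := by
  intro E
  obtain ⟨C, hC⟩ := exists_ncard_eisensteinSet_diff_le E hd
  have hprod := (multipliable_eisenstein_factor (K := K) hd).hasProd
  have hsum := (summable_one_div_primeBelow_sq (K := K)).hasSum
  refine Metric.tendsto_nhds.2 fun ε hε => ?_
  -- Four errors of `ε/4` each: truncating the product, the series tail `4 · ε/16`, the finite-level
  -- density at `H`, and the term `k/(2H)`.
  obtain ⟨S, hS1, hS2⟩ := ((Metric.tendsto_nhds.1 hprod (ε / 4) (by positivity)).and
    (Metric.tendsto_nhds.1 hsum (ε / 16) (by positivity))).exists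
  have hdens := Metric.tendsto_nhds.1
    (hasDensityWrt_exists_mem_finset E (show 1 ≤ d by omega) S) (ε / 4) (by positivity)
  have hk : Filter.Tendsto (fun H : ℕ => (Module.finrank ℚ K : ℝ) / (2 * (H : ℝ))) Filter.atTop
      (nhds 0) :=
    Filter.Tendsto.div_atTop tendsto_const_nhds
      (tendsto_natCast_atTop_atTop.const_mul_atTop two_pos)
  filter_upwards [Filter.eventually_ge_atTop C, hdens, hk.eventually_lt_const
    (show 0 < ε / 4 by positivity)] with H hH h1 h2
  have h3 := hC H hH S
  have h4 : (({a : Fin (d + 1) → 𝓞 K | ∃ v ∈ S, IsEisensteinAt v.asIdeal a} ∩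
      boxPow E (d + 1) H).ncard : ℝ) / (2 * (H : ℝ)) ^ ((d + 1) * Module.finrank ℚ K) ≤
      ((eisensteinSet K d ∩ boxPow E (d + 1) H).ncard : ℝ) /
        (2 * (H : ℝ)) ^ ((d + 1) * Module.finrank ℚ K) := by
    gcongr
    · exact (boxPow_finite E _ H).inter_of_right _
    · rw [eisensteinSet_eq]
      exact fun a ⟨v, _, hv⟩ => ⟨v, hv⟩
  rw [sub_div] at h3
  rw [Real.dist_eq, abs_lt] at hS1 hS2 h1 ⊢
  constructor <;> linarith

end

end EisensteinDensity

theorem corollary4p2 (K : Type*) [Field K] [NumberField K] (d : ℕ) (hd : 2 ≤ d) :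
    Multipliable (fun 𝔭 : IsDedekindDomain.HeightOneSpectrum (𝓞 K) =>
      1 - ((Ideal.absNorm 𝔭.asIdeal : ℝ) - 1) ^ 2 / (Ideal.absNorm 𝔭.asIdeal : ℝ) ^ (d + 2)) ∧
    EisensteinDensity.HasDensity (EisensteinDensity.eisensteinSet K d)
      (1 - ∏' 𝔭 : IsDedekindDomain.HeightOneSpectrum (𝓞 K),
        (1 - ((Ideal.absNorm 𝔭.asIdeal : ℝ) - 1) ^ 2 /
          (Ideal.absNorm 𝔭.asIdeal : ℝ) ^ (d + 2))) :=
  ⟨EisensteinDensity.multipliable_eisenstein_factor hd,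
    EisensteinDensity.hasDensity_eisensteinSet hd⟩
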